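/- Let $T$ be a random variable with distribution $F$, and let $U_1,U_2,\dots$ be i.i.d. random variables with distribution $G$, independent of $T$. Assume that $F$ and $G$ are distributions on $(0,\infty)$ with densities $f$ and $g$, that the support of $F$ is unbounded, and that $\mathbb{E}U_1<\infty$; put $\mu=1/\mathbb{E}U_1$ and $\overline G(t)=\mathbb{P}(U_1>t)$. Let $$X=T+\sum_{i=1}^{N}U_i,\qquad N=\inf\{n\ge 0:\ U_{n+1}>T\},$$ be the total time of a task of length $T$ which is restarted from scratch at each failure, and let $\overline H(x)=\mathbb{P}(X>x)$. Suppose that, for some $\beta>0$, $$f(t)=g(t)\,\overline G(t)^{\beta-1}L_0\bigl(\overline G(t)\bigr)\qquad\text{for (almost) all }t>0,$$ where $L_0:(0,\infty)\to\mathbb{R}$ is slowly varying at $0$, i.e. $L_0$ is measurable, positive near $0$, bounded on compact subsets of $(0,\infty)$, and $L_0(cs)/L_0(s)\to1$ as $s\downarrow0$ for every $c>0$. Then $$\overline H(x)\ \sim\ \frac{\Gamma(\beta)}{\mu^\beta}\,\frac{L_0(1/x)}{x^\beta},\qquad x\to\infty,$$ i.e. the ratio of the two sides tends to $1$. -/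

import Mathlib

open MeasureTheory ProbabilityTheory Filter Topology Set
open scoped ENNReal

/-- `f` is a (Lebesgue) density of the distribution `F` on `(0, ∞)`. -/
structure IsDensityOnPos (F : Measure ℝ) (f : ℝ → ℝ) : Prop where
  measurable : Measurable f
  nonneg : ∀ t, 0 < t → 0 ≤ f t
  eq_withDensity :
    F = (volume.restrict (Ioi (0 : ℝ))).withDensity (fun t => ENNReal.ofReal (f t))

/-- The tail `t ↦ ν (t, ∞)` of a distribution on the line. -/
noncomputable def distTail (ν : Measure ℝ) (t : ℝ) : ℝ := ν.real (Ioi t)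

/-- `L : (0, ∞) → ℝ` is slowly varying at `0` (values of `L` outside `(0, ∞)` are irrelevant):
`L` is (Lebesgue) measurable, positive near `0`, bounded on the compact subsets of `(0, ∞)`, and
`L (c * s) / L s → 1` as `s ↓ 0` for every `c > 0`. -/
structure IsSlowlyVaryingAtZero (L : ℝ → ℝ) : Prop where
  aemeasurable : AEMeasurable L (volume.restrict (Ioi (0 : ℝ)))
  eventually_pos : ∀ᶠ s in 𝓝[>] (0 : ℝ), 0 < L s
  bounded_on_compacts :
    ∀ K : Set ℝ, IsCompact K → K ⊆ Ioi 0 → ∃ C : ℝ, ∀ s ∈ K, |L s| ≤ C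
  tendsto_ratio : ∀ c : ℝ, 0 < c → Tendsto (fun s => L (c * s) / L s) (𝓝[>] 0) (𝓝 1)

namespace Restart

variable {Ω : Type*}

/-- The ingredients of the RESTART scheme: a task time `T` with distribution `F`, and i.i.d. failure
times `U 0, U 1, …` with distribution `G`, independent of `T`. -/
structure IsModel [MeasurableSpace Ω] (P : Measure Ω) (T : Ω → ℝ) (U : ℕ → Ω → ℝ)
    (F G : Measure ℝ) : Prop where
  measurable_task : Measurable T
  measurable_failure : ∀ i, Measurable (U i)
  law_task : P.map T = F
  law_failure : ∀ i, P.map (U i) = G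
  iIndepFun_failure : iIndepFun U P
  indepFun_task : IndepFun T (fun ω i => U i ω) P

/-- The number of failures before completion, `N = inf {n : U n > T}` with `U` indexed from `0`;
it is `∞` if the task never completes. -/
noncomputable def numFailures (T : Ω → ℝ) (U : ℕ → Ω → ℝ) (ω : Ω) : ℕ∞ :=
  sInf {n : ℕ∞ | ∃ k : ℕ, n = k ∧ T ω < U k ω}

/-- The total time `X = T + ∑_{i < N} U i`. -/
noncomputable def totalTime (T : Ω → ℝ) (U : ℕ → Ω → ℝ) (ω : Ω) : ℝ≥0∞ :=
  ENNReal.ofReal (T ω) +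
    ∑' i : ℕ, if (i : ℕ∞) < numFailures T U ω then ENNReal.ofReal (U i ω) else 0

/-- The tail `x ↦ ℙ(X > x)` of the total time. -/
noncomputable def totalTail [MeasurableSpace Ω] (P : Measure Ω) (T : Ω → ℝ) (U : ℕ → Ω → ℝ)
    (x : ℝ) : ℝ :=
  P.real {ω | ENNReal.ofReal x < totalTime T U ω}

end Restart

/-! Given `T = t`, the total time is a geometric sum of failures not exceeding `t`, followed by `t`.
Its tail solves a defective renewal equation (`restartTail_renewal`), so it decays like `exp (-γ
x)`, where `γ = γ(t)` makes `∫ u in Iic t, exp (γ u) ∂G` equal to 1. Because `G` has finite mean,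
`γ(t)` is asymptotic to `μ * distTail G t`. The exact root is never needed. For `γ = c * μ *
distTail G t` and large `t`, the integral is at least 1 when `c > 1` and at most 1 when `0 < c < 1`
(`eventually_one_le_setIntegral_exp`, `eventually_setIntegral_exp_le_one`). This gives the bounds
`exp_le_restartTail` and `restartTail_le_exp`; the extra factor `exp (γ t)` in the latter tends to 1
since `t * distTail G t → 0`.

It remains to average over `F`. The substitution `s = distTail G t` makes `G` uniform on `(0, 1)`
and turns `F` into `s ^ (β - 1) * L₀ s ds`, so long tasks contribute a Laplace transform at `c * μ *
x`. The Abelian theorem `exists_abelian`, which rests on Potter bounds, evaluates it as `Γ(β) (c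
μ)^(-β) L₀(1/x) x^(-β)`. Short tasks are exponentially negligible, and `c → 1` closes the sandwich.
-/

/-! ### Slow variation: Potter bounds and an Abelian theorem -/

theorem quasiMeasurePreserving_mul_right_Ioi {a : ℝ} (ha : 0 < a) :
    Measure.QuasiMeasurePreserving (fun c : ℝ => c * a) (volume.restrict (Ioi 0))
      (volume.restrict (Ioi 0)) := by
  have h : Measure.QuasiMeasurePreserving (fun c : ℝ => c * a) volume volume := by
    refine ⟨by fun_prop, Measure.AbsolutelyContinuous.mk fun s hs h0 => ?_⟩
    rw [Measure.map_apply (by fun_prop) hs, Real.volume_preimage_mul_right ha.ne', h0, mul_zero]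
  exact h.restrict fun c hc => mul_pos hc ha

namespace IsSlowlyVaryingAtZero

variable {L : ℝ → ℝ}

theorem aemeasurable_comp_mul (hL : IsSlowlyVaryingAtZero L) {a : ℝ} (ha : 0 < a) :
    AEMeasurable (fun c => L (c * a)) (volume.restrict (Ioi (0 : ℝ))) :=
  hL.aemeasurable.comp_quasiMeasurePreserving (quasiMeasurePreserving_mul_right_Ioi ha)

/-- On a set of finite measure pointwise convergence implies convergence in measure. This replaces
the uniform convergence theorem: it is enough to find one good dilation `c`. -/
theorem tendsto_volume_exceptional (hL : IsSlowlyVaryingAtZero L) {ε : ℝ} (hε : 0 < ε) :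
    Tendsto (fun s => volume ({c | ε ≤ |L (c * s) / L s - 1|} ∩ Icc 1 4)) (𝓝[>] 0) (𝓝 0) := by
  refine tendsto_of_seq_tendsto fun v hv => ?_
  have hpos : ∀ᶠ n in atTop, 0 < v n := hv.eventually self_mem_nhdsWithin
  obtain ⟨m, hm⟩ := eventually_atTop.1 hpos
  -- Dropping the first `m` terms makes every dilation factor positive, as measurability of `L (c *
  -- v n)` requires.
  rw [← tendsto_add_atTop_iff_nat m]
  have hsub : Icc (1 : ℝ) 4 ⊆ Ioi 0 := fun c hc => lt_of_lt_of_le one_pos hc.1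
  have key : TendstoInMeasure (volume.restrict (Icc (1 : ℝ) 4))
      (fun (n : ℕ) c => L (c * v (n + m)) / L (v (n + m))) atTop (fun _ => (1 : ℝ)) := by
    refine tendstoInMeasure_of_tendsto_ae (fun n => ?_) ?_
    · exact (((hL.aemeasurable_comp_mul (hm _ (by omega))).mono_measure
        (Measure.restrict_mono hsub le_rfl)).div_const _).aestronglyMeasurable
    · filter_upwards [ae_restrict_mem measurableSet_Icc] with c hc
      exact ((hL.tendsto_ratio c (hsub hc)).comp hv).comp (tendsto_add_atTop_nat m)
  have := key (ENNReal.ofReal ε) (by simpa using hε)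
  refine this.congr fun n => ?_
  rw [Measure.restrict_apply' measurableSet_Icc]
  congr 2
  ext c
  simp only [mem_ofPred_eq, edist_dist, Real.dist_eq]
  rw [ENNReal.ofReal_le_ofReal_iff (abs_nonneg _)]

theorem exists_forall_pos (hL : IsSlowlyVaryingAtZero L) : ∃ s₀ > 0, ∀ s ∈ Ioo 0 s₀, 0 < L s := by
  obtain ⟨s₀, h0, h⟩ := mem_nhdsGT_iff_exists_Ioo_subset.1 hL.eventually_pos
  exact ⟨s₀, h0, h⟩

/-- Uniform two-sided control of the ratio on a dyadic block. -/
theorem exists_ratio_bound (hL : IsSlowlyVaryingAtZero L) {K : ℝ} (hK : 1 < K) :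
    ∃ s₀ > 0, (∀ s ∈ Ioo 0 s₀, 0 < L s) ∧
      ∀ s > 0, ∀ u ∈ Icc (1 : ℝ) 2, u * s < s₀ → L (u * s) ≤ K * L s ∧ L s ≤ K * L (u * s) := by
  obtain ⟨s₁, hs₁, hpos⟩ := hL.exists_forall_pos
  -- Chosen so that `(1 + ε) / (1 - ε) = K`.
  obtain ⟨ε, hε⟩ : ∃ ε : ℝ, ε = (K - 1) / (K + 1) := ⟨_, rfl⟩
  have hε0 : 0 < ε := by rw [hε]; apply div_pos <;> linarith
  have hε1 : 0 < 1 - ε := by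
    have : 1 - ε = 2 / (K + 1) := by rw [hε]; field_simp; ring
    rw [this]; apply div_pos <;> linarith
  have hεK : 1 + ε = K * (1 - ε) := by rw [hε]; field_simp; ring
  have hev : ∀ᶠ s in 𝓝[>] (0 : ℝ),
      volume ({c | ε ≤ |L (c * s) / L s - 1|} ∩ Icc 1 4) < ENNReal.ofReal (1 / 2) :=
    (hL.tendsto_volume_exceptional hε0).eventually_lt_const (by simp)
  obtain ⟨s₂, hs₂, hsmall⟩ := mem_nhdsGT_iff_exists_Ioo_subset.1 hev
  have hs₂' : (0 : ℝ) < s₂ := hs₂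
  refine ⟨min s₁ s₂, lt_min hs₁ hs₂', fun s hs => hpos s ⟨hs.1, hs.2.trans_le (min_le_left _ _)⟩,
    fun s hs u hu hus => ?_⟩
  have hu0 : 0 < u := lt_of_lt_of_le one_pos hu.1
  have hus0 : 0 < u * s := mul_pos hu0 hs
  have hsu : s ≤ u * s := le_mul_of_one_le_left hs.le hu.1
  have hs1 : 0 < L s := hpos s ⟨hs, lt_of_le_of_lt hsu (hus.trans_le (min_le_left _ _))⟩
  have hus1 : 0 < L (u * s) := hpos _ ⟨hus0, hus.trans_le (min_le_left _ _)⟩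
  have h1 := hsmall ⟨hs, lt_of_le_of_lt hsu (hus.trans_le (min_le_right _ _))⟩
  have h2 := hsmall ⟨hus0, hus.trans_le (min_le_right _ _)⟩
  simp only [mem_ofPred_eq] at h1 h2
  -- `L s` and `L (u * s)` are compared through a common value `L (c * s)` with `c ∈ [2, 4]`. The
  -- `c` that are bad for `s` have measure below 1/2; those bad for `u * s` form a `u`-dilate of
  -- such a set, of measure at most 1. Together they cannot cover an interval of length 2. Dividing
  -- by `u ∈ [1, 2]` keeps `c` in the window `[1, 4]`.
  obtain ⟨c, hcs, hcu⟩ : ∃ c : ℝ, |L (c * s) / L s - 1| < ε ∧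
      |L (c * s) / L (u * s) - 1| < ε := by
    by_contra! hcon
    have hsub : Icc (2 : ℝ) 4 ⊆ ({c | ε ≤ |L (c * s) / L s - 1|} ∩ Icc 1 4) ∪
        (fun c => c * u⁻¹) ⁻¹' ({c | ε ≤ |L (c * (u * s)) / L (u * s) - 1|} ∩ Icc 1 4) := by
      intro c hc
      by_cases hcs : ε ≤ |L (c * s) / L s - 1|
      · exact Or.inl ⟨hcs, by linarith [hc.1], hc.2⟩
      · refine Or.inr ⟨?_, ?_, ?_⟩
        · have : c * u⁻¹ * (u * s) = c * s := by field_simp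
          simpa only [mem_ofPred_eq, this] using hcon c (not_le.1 hcs)
        · change 1 ≤ c * u⁻¹
          rw [← div_eq_mul_inv, le_div_iff₀ hu0]; linarith [hc.1, hu.2]
        · change c * u⁻¹ ≤ 4
          rw [← div_eq_mul_inv, div_le_iff₀ hu0]; linarith [hc.2, hu.1]
    have hle := (measure_mono hsub).trans (measure_union_le (μ := volume) _ _)
    rw [Real.volume_preimage_mul_right (inv_ne_zero hu0.ne'), Real.volume_Icc, inv_inv,
      abs_of_pos hu0] at hle
    have hle2 : ENNReal.ofReal (4 - 2) ≤ ENNReal.ofReal (1 / 2) +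
        ENNReal.ofReal 2 * ENNReal.ofReal (1 / 2) :=
      hle.trans (add_le_add h1.le (mul_le_mul' (ENNReal.ofReal_le_ofReal hu.2) h2.le))
    rw [← ENNReal.ofReal_mul (by norm_num), ← ENNReal.ofReal_add (by norm_num) (by norm_num),
      ENNReal.ofReal_le_ofReal_iff (by norm_num)] at hle2
    norm_num at hle2
  rw [abs_lt] at hcs hcu
  have a1 : L (c * s) < (1 + ε) * L s := by rw [← div_lt_iff₀ hs1]; linarith
  have a2 : (1 - ε) * L s < L (c * s) := by rw [← lt_div_iff₀ hs1]; linarith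
  have a3 : L (c * s) < (1 + ε) * L (u * s) := by rw [← div_lt_iff₀ hus1]; linarith
  have a4 : (1 - ε) * L (u * s) < L (c * s) := by rw [← lt_div_iff₀ hus1]; linarith
  rw [hεK] at a1 a3
  constructor
  · exact (lt_of_mul_lt_mul_left (by linarith : (1 - ε) * L (u * s) < (1 - ε) * (K * L s))
      hε1.le).le
  · exact (lt_of_mul_lt_mul_left (by linarith : (1 - ε) * L s < (1 - ε) * (K * L (u * s)))
      hε1.le).le

/-- Potter bounds. -/
theorem exists_potter_bound (hL : IsSlowlyVaryingAtZero L) {δ : ℝ} (hδ : 0 < δ) :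
    ∃ s₀ > 0, (∀ s ∈ Ioo 0 s₀, 0 < L s) ∧
      ∀ s > 0, ∀ u : ℝ, 1 ≤ u → u * s < s₀ →
        L (u * s) ≤ 2 ^ δ * u ^ δ * L s ∧ L s ≤ 2 ^ δ * u ^ δ * L (u * s) := by
  have hK : (1 : ℝ) < 2 ^ δ := Real.one_lt_rpow (by norm_num) hδ
  have hK0 : (0 : ℝ) < 2 ^ δ := by positivity
  obtain ⟨s₀, hs₀, hpos, hblock⟩ := hL.exists_ratio_bound hK
  refine ⟨s₀, hs₀, hpos, ?_⟩
  -- Each halving of `u` costs a factor `2 ^ δ`, which is exactly the loss from `u ^ δ` to `(u / 2)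
  -- ^ δ`; the prefactor `2 ^ δ` pays for the last, incomplete block.
  have main : ∀ n : ℕ, ∀ s > 0, ∀ u : ℝ, 1 ≤ u → u ≤ 2 ^ n → u * s < s₀ →
      L (u * s) ≤ 2 ^ δ * u ^ δ * L s ∧ L s ≤ 2 ^ δ * u ^ δ * L (u * s) := by
    intro n
    induction n with
    | zero =>
      intro s hs u hu1 hu2 hus
      obtain rfl : u = 1 := le_antisymm (by simpa using hu2) hu1
      have := hpos s ⟨hs, by simpa using hus⟩
      simp only [one_mul, Real.one_rpow, mul_one]
      constructor <;> nlinarith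
    | succ n ih =>
      intro s hs u hu1 hu2 hus
      have hu0 : 0 < u := lt_of_lt_of_le one_pos hu1
      rcases le_total u 2 with hle | hge
      · have hb := hblock s hs u ⟨hu1, hle⟩ hus
        have hsp : 0 < L s := hpos s ⟨hs, lt_of_le_of_lt (le_mul_of_one_le_left hs.le hu1) hus⟩
        have husp : 0 < L (u * s) := hpos _ ⟨by positivity, hus⟩
        have hud : 1 ≤ u ^ δ := Real.one_le_rpow hu1 hδ.le
        have hK2 : (2 : ℝ) ^ δ ≤ 2 ^ δ * u ^ δ := le_mul_of_one_le_right hK0.le hud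
        exact ⟨hb.1.trans (mul_le_mul_of_nonneg_right hK2 hsp.le),
          hb.2.trans (mul_le_mul_of_nonneg_right hK2 husp.le)⟩
      · have e : u * s = u / 2 * (2 * s) := by ring
        have h2s : 2 * s < s₀ := lt_of_le_of_lt (mul_le_mul_of_nonneg_right hge hs.le) hus
        have hi := ih (2 * s) (by positivity) (u / 2) (by linarith)
          (by rw [pow_succ] at hu2; linarith) (by rw [← e]; exact hus)
        have hb := hblock s hs 2 ⟨by norm_num, le_rfl⟩ h2s
        rw [← e, Real.div_rpow hu0.le (by norm_num), mul_div_cancel₀ _ hK0.ne'] at hi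
        have hud : 0 ≤ u ^ δ := by positivity
        constructor
        · calc L (u * s) ≤ u ^ δ * L (2 * s) := hi.1
            _ ≤ u ^ δ * (2 ^ δ * L s) := mul_le_mul_of_nonneg_left hb.1 hud
            _ = _ := by ring
        · calc L s ≤ 2 ^ δ * L (2 * s) := hb.2
            _ ≤ 2 ^ δ * (u ^ δ * L (u * s)) := mul_le_mul_of_nonneg_left hi.2 hK0.le
            _ = _ := by ring
  intro s hs u hu hus
  obtain ⟨n, hn⟩ := pow_unbounded_of_one_lt u (by norm_num : (1 : ℝ) < 2)
  exact main n s hs u hu hn.le hus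

/-- An Abelian theorem for Laplace transforms of regularly varying densities at `0`. -/
theorem exists_abelian (hL : IsSlowlyVaryingAtZero L) {β : ℝ} (hβ : 0 < β) :
    ∃ s₀ > 0, (∀ s ∈ Ioo 0 s₀, 0 < L s) ∧ ∀ s₁ ∈ Ioc 0 s₀, ∀ r > 0,
      Tendsto (fun x => (∫ s in Ioo 0 s₁, Real.exp (-(r * x * s)) * (s ^ (β - 1) * L s)) /
        (L (1 / x) / x ^ β)) atTop (𝓝 (Real.Gamma β / r ^ β)) := by
  have hδ : 0 < β / 2 := by positivity
  -- Any `δ` in `(0, β)` would do: `β - δ > 0` keeps the dominating function integrable at 0.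
  obtain ⟨δ, hδe⟩ : ∃ δ, δ = β / 2 := ⟨_, rfl⟩
  rw [← hδe] at hδ
  obtain ⟨s₀, hs₀, hpos, hpot⟩ := hL.exists_potter_bound hδ
  refine ⟨s₀, hs₀, hpos, fun s₁ hs₁ r hr => ?_⟩
  have hratio : ∀ x > 0, ∀ y > 0, 1 / x < s₀ → y * x⁻¹ < s₀ →
      ‖L (y * x⁻¹) / L (1 / x)‖ ≤ 2 ^ δ * (y ^ δ + y ^ (-δ)) := by
    intro x hx y hy h1 h2
    have p1 := hpos (1 / x) ⟨by positivity, h1⟩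
    have p2 := hpos (y * x⁻¹) ⟨by positivity, h2⟩
    rw [Real.norm_of_nonneg (by positivity), div_le_iff₀ p1]
    have q1 : 0 ≤ y ^ δ := by positivity
    have q2 : 0 ≤ y ^ (-δ) := by positivity
    have q3 : (0 : ℝ) < 2 ^ δ := by positivity
    rcases le_total 1 y with hy1 | hy1
    · have := (hpot (1 / x) (by positivity) y hy1 (by simpa using h2)).1
      rw [one_div] at this ⊢
      refine this.trans (mul_le_mul_of_nonneg_right ?_ (by simpa using p1.le))
      exact mul_le_mul_of_nonneg_left (by linarith) q3.le
    · have e : y⁻¹ * (y * x⁻¹) = 1 / x := by field_simp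
      have := (hpot (y * x⁻¹) (by positivity) y⁻¹ ((one_le_inv₀ hy).2 hy1) (by rw [e]; exact h1)).2
      rw [e, Real.inv_rpow hy.le, ← Real.rpow_neg hy.le] at this
      refine this.trans (mul_le_mul_of_nonneg_right ?_ p1.le)
      exact mul_le_mul_of_nonneg_left (by linarith) q3.le
  have hint : ∀ a : ℝ, 0 < a → IntegrableOn (fun y : ℝ => y ^ (a - 1) * Real.exp (-(r * y))) (Ioi 0) := by
    intro a ha
    have := integrableOn_rpow_mul_exp_neg_mul_rpow (s := a - 1) (p := 1) (by linarith) one_pos hr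
    simpa using this
  -- The integral after the substitution `y = x * s`; the indicator records the cutoff `s < s₁`,
  -- which disappears in the limit.
  have hlim : Tendsto (fun x : ℝ => ∫ y in Ioi (0 : ℝ),
      (Iio s₁).indicator (fun _ => y ^ (β - 1) * Real.exp (-(r * y)) * (L (y * x⁻¹) / L (1 / x)))
        (y * x⁻¹)) atTop (𝓝 (∫ y in Ioi (0 : ℝ), y ^ (β - 1) * Real.exp (-(r * y)))) := by
    refine tendsto_integral_filter_of_dominated_convergence
      (fun y => 2 ^ δ * (y ^ (β + δ - 1) * Real.exp (-(r * y)) +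
        y ^ (β - δ - 1) * Real.exp (-(r * y)))) ?_ ?_ ?_ ?_
    · filter_upwards [eventually_gt_atTop 0] with x hx
      have hm : AEMeasurable (fun y : ℝ => y ^ (β - 1) * Real.exp (-(r * y)) *
          (L (y * x⁻¹) / L (1 / x))) (volume.restrict (Ioi 0)) :=
        (by fun_prop : Measurable fun y : ℝ => y ^ (β - 1) * Real.exp (-(r * y))).aemeasurable.mul
          ((hL.aemeasurable_comp_mul (inv_pos.2 hx)).div_const _)
      have hms : MeasurableSet {y : ℝ | y * x⁻¹ ∈ Iio s₁} :=
        measurableSet_Iio.preimage (by fun_prop : Measurable fun y : ℝ => y * x⁻¹)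
      exact (hm.indicator hms).aestronglyMeasurable
    · have hx0 : ∀ᶠ x : ℝ in atTop, 1 / x < s₀ := by
        simpa using tendsto_inv_atTop_zero.eventually_lt_const hs₀
      filter_upwards [eventually_gt_atTop 0, hx0] with x hx hx1
      filter_upwards [ae_restrict_mem measurableSet_Ioi] with y hy
      have hy' : 0 < y := hy
      have hsplit : 2 ^ δ * (y ^ (β + δ - 1) * Real.exp (-(r * y)) +
          y ^ (β - δ - 1) * Real.exp (-(r * y))) =
          y ^ (β - 1) * Real.exp (-(r * y)) * (2 ^ δ * (y ^ δ + y ^ (-δ))) := by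
        rw [show β + δ - 1 = β - 1 + δ by ring, show β - δ - 1 = β - 1 + -δ by ring,
          Real.rpow_add hy', Real.rpow_add hy']
        ring
      rw [hsplit]
      by_cases h : y * x⁻¹ ∈ Iio s₁
      · rw [indicator_of_mem h, norm_mul, Real.norm_of_nonneg (by positivity)]
        exact mul_le_mul_of_nonneg_left (hratio x hx y hy' hx1 (lt_of_lt_of_le h hs₁.2))
          (by positivity)
      · rw [indicator_of_notMem h, norm_zero]
        positivity
    · exact ((hint (β + δ) (by linarith)).add (hint (β - δ) (by linarith))).const_mul _
    · filter_upwards [ae_restrict_mem measurableSet_Ioi] with y hy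
      have hy' : 0 < y := hy
      have t1 : Tendsto (fun x : ℝ => 1 / x) atTop (𝓝[>] 0) := by
        simpa using tendsto_inv_atTop_nhdsGT_zero
      have t2 := (hL.tendsto_ratio y hy').comp t1
      have t3 : Tendsto (fun x : ℝ => y * x⁻¹) atTop (𝓝 0) := by
        simpa using tendsto_inv_atTop_zero.const_mul y
      have t4 := t2.const_mul (y ^ (β - 1) * Real.exp (-(r * y)))
      rw [mul_one] at t4
      refine t4.congr' ?_
      filter_upwards [t3.eventually_lt_const hs₁.1] with x hx
      rw [indicator_of_mem (mem_Iio.2 hx)]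
      simp
  rw [Real.integral_rpow_mul_exp_neg_mul_Ioi hβ hr, Real.div_rpow zero_le_one hr.le,
    Real.one_rpow, one_div_mul_eq_div] at hlim
  refine hlim.congr' ?_
  filter_upwards [eventually_gt_atTop 0] with x hx
  have hchange := integral_comp_mul_right_Ioi (fun s : ℝ => (Iio s₁).indicator
    (fun s => Real.exp (-(r * x * s)) * (s ^ (β - 1) * L s)) s) 0 (inv_pos.2 hx)
  rw [zero_mul, inv_inv, setIntegral_indicator measurableSet_Iio, Ioi_inter_Iio, smul_eq_mul]
    at hchange
  have hx' : 0 < x ^ β := by positivity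
  have hI : ∫ s in Ioo 0 s₁, Real.exp (-(r * x * s)) * (s ^ (β - 1) * L s) =
      x⁻¹ * ∫ y in Ioi (0 : ℝ), (Iio s₁).indicator
        (fun s => Real.exp (-(r * x * s)) * (s ^ (β - 1) * L s)) (y * x⁻¹) := by
    rw [hchange, inv_mul_cancel_left₀ hx.ne']
  have hI' : (∫ s in Ioo 0 s₁, Real.exp (-(r * x * s)) * (s ^ (β - 1) * L s)) /
      (L (1 / x) / x ^ β) = ∫ y in Ioi (0 : ℝ), x ^ β / (x * L (1 / x)) * (Iio s₁).indicator
        (fun s => Real.exp (-(r * x * s)) * (s ^ (β - 1) * L s)) (y * x⁻¹) := by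
    rw [integral_const_mul, hI, div_div_eq_mul_div, ← div_div, div_eq_mul_inv (x ^ β) x]
    ring
  rw [hI']
  refine setIntegral_congr_fun measurableSet_Ioi fun y hy => ?_
  have hy' : 0 < y := hy
  by_cases h : y * x⁻¹ ∈ Iio s₁
  · simp only [indicator_of_mem h]
    have e1 : r * x * (y * x⁻¹) = r * y := by field_simp
    have e2 : (y * x⁻¹) ^ (β - 1) = y ^ (β - 1) * (x / x ^ β) := by
      rw [Real.mul_rpow hy'.le (inv_pos.2 hx).le, Real.inv_rpow hx.le, Real.rpow_sub_one hx.ne',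
        inv_div]
    rw [e1, e2, ← div_div]
    field_simp
  · simp only [indicator_of_notMem h, mul_zero]

end IsSlowlyVaryingAtZero

/-! ### I.i.d. sequences and the restart time as a function of task and failures -/

/-- Prepend a term to a sequence. -/
def seqCons (a : ℝ) (u : ℕ → ℝ) : ℕ → ℝ
  | 0 => a
  | n + 1 => u n

theorem measurable_seqCons : Measurable fun p : ℝ × (ℕ → ℝ) => seqCons p.1 p.2 := by
  refine measurable_pi_iff.2 fun n => ?_
  cases n with
  | zero => exact measurable_fst
  | succ n => exact (measurable_pi_apply n).comp measurable_snd

/-- This is what allows conditioning on the first failure: the rest of the sequence is a fresh copy,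
independent of it. -/
theorem map_seqCons_prod_infinitePi (G : Measure ℝ) [IsProbabilityMeasure G] :
    (G.prod (Measure.infinitePi fun _ : ℕ => G)).map (fun p => seqCons p.1 p.2) =
      Measure.infinitePi fun _ : ℕ => G := by
  classical
  refine Measure.eq_infinitePi _ fun s t ht => ?_
  obtain ⟨n, hn⟩ := s.exists_nat_subset_range
  have hn' : s ⊆ Finset.range (n + 1) := hn.trans (Finset.range_mono n.le_succ)
  -- Padding with `univ` gives a cylinder over an initial segment of `ℕ`, from which coordinate 0
  -- splits off.
  let t' : ℕ → Set ℝ := fun i => if i ∈ s then t i else univ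
  have ht' : ∀ i, MeasurableSet (t' i) := by
    intro i
    by_cases h : i ∈ s
    · simpa [t', h] using ht i
    · simp [t', h]
  have hpi : Set.pi (s : Set ℕ) t = Set.pi (Finset.range (n + 1) : Set ℕ) t' := by
    ext u
    simp only [Set.mem_pi, SetLike.mem_coe]
    constructor
    · intro h i _
      by_cases his : i ∈ s
      · simpa [t', his] using h i his
      · simp [t', his]
    · intro h i his
      simpa [t', his] using h i (hn' his)
  have hprod : ∏ i ∈ s, G (t i) = ∏ i ∈ Finset.range (n + 1), G (t' i) := by
    rw [← Finset.prod_subset hn' (f := fun i => G (t' i))]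
    · exact Finset.prod_congr rfl fun i his => by simp [t', his]
    · intro i _ his
      simp [t', his]
  have hpre : (fun p : ℝ × (ℕ → ℝ) => seqCons p.1 p.2) ⁻¹'
      Set.pi (Finset.range (n + 1) : Set ℕ) t' =
      t' 0 ×ˢ Set.pi (Finset.range n : Set ℕ) (fun i => t' (i + 1)) := by
    ext p
    simp only [mem_preimage, Set.mem_pi, SetLike.mem_coe, Finset.mem_range, mem_prod]
    constructor
    · exact fun h => ⟨h 0 (by omega), fun i hi => h (i + 1) (by omega)⟩
    · rintro ⟨h0, h1⟩ i hi
      cases i with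
      | zero => exact h0
      | succ i => exact h1 i (by omega)
  rw [hpi, hprod, Measure.map_apply measurable_seqCons
    (MeasurableSet.pi (Finset.countable_toSet _) fun i _ => ht' i), hpre, Measure.prod_prod,
    Measure.infinitePi_pi _ (fun i _ => ht' _), Finset.prod_range_succ', mul_comm]

namespace Restart

/-- The total time of a task of length `t` under the failure times `u`. -/
noncomputable def restartTime (t : ℝ) (u : ℕ → ℝ) : ℝ≥0∞ :=
  ENNReal.ofReal t + ∑' i : ℕ, if ∀ j ≤ i, u j ≤ t then ENNReal.ofReal (u i) else 0

theorem coe_lt_numFailures_iff {Ω : Type*} (T : Ω → ℝ) (U : ℕ → Ω → ℝ) (ω : Ω) (i : ℕ) :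
    (i : ℕ∞) < numFailures T U ω ↔ ∀ j ≤ i, U j ω ≤ T ω := by
  constructor
  · intro h j hj
    by_contra! hlt
    have h1 : numFailures T U ω ≤ (j : ℕ∞) := sInf_le ⟨j, rfl, hlt⟩
    exact absurd (h.trans_le h1) (not_lt.2 (by exact_mod_cast hj))
  · intro h
    have h1 : ((i + 1 : ℕ) : ℕ∞) ≤ numFailures T U ω := by
      refine le_sInf ?_
      rintro _ ⟨k, rfl, hk⟩
      have : i < k := by
        by_contra! hki
        exact absurd hk (not_lt.2 (h k hki))
      exact_mod_cast this
    exact lt_of_lt_of_le (by exact_mod_cast i.lt_succ_self) h1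

theorem totalTime_eq_restartTime {Ω : Type*} (T : Ω → ℝ) (U : ℕ → Ω → ℝ) (ω : Ω) :
    totalTime T U ω = restartTime (T ω) (fun i => U i ω) := by
  classical
  unfold totalTime restartTime
  congr 1
  refine tsum_congr fun i => ?_
  exact if_congr (coe_lt_numFailures_iff T U ω i) rfl rfl

theorem measurable_restartTime : Measurable fun p : ℝ × (ℕ → ℝ) => restartTime p.1 p.2 := by
  have hm : ∀ j, Measurable fun p : ℝ × (ℕ → ℝ) => p.2 j := fun j =>
    (measurable_pi_apply j).comp measurable_snd
  refine (measurable_fst.ennreal_ofReal).add (Measurable.tsum fun i => ?_)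
  refine Measurable.ite ?_ (hm i).ennreal_ofReal measurable_const
  have : {p : ℝ × (ℕ → ℝ) | ∀ j ≤ i, p.2 j ≤ p.1} =
      ⋂ j, ⋂ (_ : j ≤ i), {p : ℝ × (ℕ → ℝ) | p.2 j ≤ p.1} := by
    ext p; simp
  rw [this]
  exact MeasurableSet.iInter fun j => MeasurableSet.iInter fun _ =>
    measurableSet_le (hm j) measurable_fst

theorem restartTime_seqCons_of_le {t a : ℝ} (h : a ≤ t) (u : ℕ → ℝ) :
    restartTime t (seqCons a u) = ENNReal.ofReal a + restartTime t u := by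
  classical
  unfold restartTime
  rw [tsum_eq_zero_add' ENNReal.summable, add_left_comm]
  congr 1
  · simp [seqCons, h]
  · congr 1
    refine tsum_congr fun i => if_congr ?_ rfl rfl
    constructor
    · exact fun hi j hj => hi (j + 1) (by omega)
    · intro hi j hj
      cases j with
      | zero => exact h
      | succ j => exact hi j (by omega)

theorem restartTime_seqCons_of_lt {t a : ℝ} (h : t < a) (u : ℕ → ℝ) :
    restartTime t (seqCons a u) = ENNReal.ofReal t := by
  classical
  unfold restartTime
  have : ∀ i : ℕ, ¬ ∀ j ≤ i, seqCons a u j ≤ t := fun i hi => absurd (hi 0 i.zero_le) (not_le.2 h)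
  simp [this]

theorem ofReal_le_restartTime (t : ℝ) (u : ℕ → ℝ) : ENNReal.ofReal t ≤ restartTime t u :=
  le_self_add

/-! ### Renewal equation and exponential bounds for a fixed task length -/

/-- The tail of the total time of a task of length `t` under i.i.d. failures with law `G`. -/
noncomputable def restartTail (G : Measure ℝ) [IsProbabilityMeasure G] (t x : ℝ) : ℝ :=
  (Measure.infinitePi fun _ : ℕ => G).real {u | ENNReal.ofReal x < restartTime t u}

section

variable (G : Measure ℝ) [IsProbabilityMeasure G]

theorem restartTail_nonneg (t x : ℝ) : 0 ≤ restartTail G t x := measureReal_nonneg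

theorem restartTail_le_one (t x : ℝ) : restartTail G t x ≤ 1 := measureReal_le_one

theorem restartTail_of_lt {t x : ℝ} (hx : 0 ≤ x) (h : x < t) : restartTail G t x = 1 := by
  have : {u | ENNReal.ofReal x < restartTime t u} = univ := by
    refine eq_univ_of_forall fun u => ?_
    exact lt_of_lt_of_le ((ENNReal.ofReal_lt_ofReal_iff (hx.trans_lt h)).2 h)
      (ofReal_le_restartTime t u)
  simp [restartTail, this]

theorem measurable_restartTail_shift (t x : ℝ) : Measurable fun u => restartTail G t (x - u) := by
  have hs : MeasurableSet {p : ℝ × (ℕ → ℝ) | ENNReal.ofReal (x - p.1) < restartTime t p.2} :=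
    measurableSet_lt (by fun_prop)
      (measurable_restartTime.comp (measurable_const.prodMk measurable_snd))
  exact (measurable_measure_prodMk_left hs).ennreal_toReal

theorem measurable_restartTail_left (x : ℝ) : Measurable fun t => restartTail G t x := by
  have hs : MeasurableSet {p : ℝ × (ℕ → ℝ) | ENNReal.ofReal x < restartTime p.1 p.2} :=
    measurableSet_lt measurable_const measurable_restartTime
  exact (measurable_measure_prodMk_left hs).ennreal_toReal

/-- The renewal equation obtained by conditioning on the first failure. -/
theorem restartTail_renewal (hG : ∀ᵐ u ∂G, 0 < u) {t x : ℝ} (htx : t ≤ x) :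
    restartTail G t x = ∫ u in Iic t, restartTail G t (x - u) ∂G := by
  have hm : MeasurableSet {u : ℕ → ℝ | ENNReal.ofReal x < restartTime t u} :=
    measurableSet_lt measurable_const
      (measurable_restartTime.comp (measurable_const.prodMk measurable_id))
  have key : (Measure.infinitePi fun _ : ℕ => G) {u | ENNReal.ofReal x < restartTime t u} =
      ∫⁻ a in Iic t, (Measure.infinitePi fun _ : ℕ => G)
        {u | ENNReal.ofReal (x - a) < restartTime t u} ∂G := by
    conv_lhs => rw [← map_seqCons_prod_infinitePi G]
    rw [Measure.map_apply measurable_seqCons hm, Measure.prod_apply (measurable_seqCons hm),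
      ← lintegral_indicator measurableSet_Iic]
    refine lintegral_congr_ae ?_
    filter_upwards [hG] with a ha
    by_cases hat : a ≤ t
    · rw [indicator_of_mem (mem_Iic.2 hat)]
      congr 1
      ext u
      change ENNReal.ofReal x < restartTime t (seqCons a u) ↔
        ENNReal.ofReal (x - a) < restartTime t u
      have hx : ENNReal.ofReal x = ENNReal.ofReal a + ENNReal.ofReal (x - a) := by
        rw [← ENNReal.ofReal_add ha.le (by linarith)]; congr 1; ring
      rw [restartTime_seqCons_of_le hat, hx, ENNReal.add_lt_add_iff_left ENNReal.ofReal_ne_top]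
    -- Here the first attempt succeeds, so the total time is `t ≤ x` and the event is empty.
    · rw [indicator_of_notMem (by simpa using hat)]
      convert measure_empty (μ := Measure.infinitePi fun _ : ℕ => G)
      refine eq_empty_of_forall_notMem fun u hu => ?_
      change ENNReal.ofReal x < restartTime t (seqCons a u) at hu
      rw [restartTime_seqCons_of_lt (not_le.1 hat)] at hu
      exact absurd hu (not_lt.2 (ENNReal.ofReal_le_ofReal htx))
  unfold restartTail Measure.real
  rw [integral_toReal, key]
  · have hs : MeasurableSet {p : ℝ × (ℕ → ℝ) | ENNReal.ofReal (x - p.1) < restartTime t p.2} :=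
      measurableSet_lt (by fun_prop)
        (measurable_restartTime.comp (measurable_const.prodMk measurable_snd))
    exact (measurable_measure_prodMk_left hs).aemeasurable
  · exact ae_of_all _ fun a => measure_lt_top _ _

theorem integrable_restartTail_shift (t x : ℝ) (s : Set ℝ) :
    IntegrableOn (fun u => restartTail G t (x - u)) s G :=
  Integrable.of_bound (measurable_restartTail_shift G t x).aestronglyMeasurable 1
    (ae_of_all _ fun u => by
      rw [Real.norm_of_nonneg (restartTail_nonneg G _ _)]; exact restartTail_le_one G _ _)

theorem integrableOn_exp_mul_Iic {γ : ℝ} (hγ : 0 ≤ γ) (t : ℝ) :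
    IntegrableOn (fun u => Real.exp (γ * u)) (Iic t) G := by
  refine Integrable.of_bound (by fun_prop) (Real.exp (γ * t)) ?_
  filter_upwards [ae_restrict_mem measurableSet_Iic] with u hu
  rw [Real.norm_of_nonneg (Real.exp_pos _).le]
  exact Real.exp_le_exp.2 (mul_le_mul_of_nonneg_left hu hγ)

/-- Lundberg's inequality for the total time. -/
theorem restartTail_le_exp (hG : ∀ᵐ u ∂G, 0 < u) {t γ : ℝ} (hγ : 0 ≤ γ)
    (hq : G.real (Iic t) < 1) (hψ : ∫ u in Iic t, Real.exp (γ * u) ∂G ≤ 1) {x : ℝ} (hx : 0 ≤ x) :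
    restartTail G t x ≤ Real.exp (γ * (t - x)) := by
  -- Iterate the renewal equation from the trivial bound 1. The exponential is a supersolution
  -- because of `hψ`, and each iteration multiplies the error by `G.real (Iic t) < 1`.
  have main : ∀ n : ℕ, ∀ x, 0 ≤ x →
      restartTail G t x ≤ Real.exp (γ * (t - x)) + G.real (Iic t) ^ n := by
    intro n
    induction n with
    | zero =>
      intro x _
      have := restartTail_le_one G t x
      have := Real.exp_pos (γ * (t - x))
      rw [pow_zero]; linarith
    | succ n ih =>
      intro x hx
      rcases lt_or_ge x t with hxt | hxt
      · have := restartTail_le_one G t x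
        have : 1 ≤ Real.exp (γ * (t - x)) := Real.one_le_exp (mul_nonneg hγ (by linarith))
        have : 0 ≤ G.real (Iic t) ^ (n + 1) := by positivity
        linarith
      · have hi1 : IntegrableOn (fun u => Real.exp (γ * (t - x)) * Real.exp (γ * u)) (Iic t) G :=
          (integrableOn_exp_mul_Iic G hγ t).const_mul _
        have hi2 : IntegrableOn (fun _ => G.real (Iic t) ^ n) (Iic t) G :=
          integrableOn_const (measure_ne_top _ _)
        calc restartTail G t x = ∫ u in Iic t, restartTail G t (x - u) ∂G :=
              restartTail_renewal G hG hxt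
          _ ≤ ∫ u in Iic t, (Real.exp (γ * (t - x)) * Real.exp (γ * u) + G.real (Iic t) ^ n) ∂G := by
              refine setIntegral_mono_on (integrable_restartTail_shift G t x _) (hi1.add hi2)
                measurableSet_Iic fun u hu => ?_
              have hu' : u ≤ t := hu
              have := ih (x - u) (by linarith)
              rwa [show γ * (t - (x - u)) = γ * (t - x) + γ * u by ring, Real.exp_add] at this
          _ = Real.exp (γ * (t - x)) * ∫ u in Iic t, Real.exp (γ * u) ∂G +
              G.real (Iic t) ^ (n + 1) := by
              rw [integral_add hi1 hi2, integral_const_mul, setIntegral_const, smul_eq_mul,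
                pow_succ']
          _ ≤ _ := by
              have := mul_le_mul_of_nonneg_left hψ (Real.exp_pos (γ * (t - x))).le
              linarith
  have hlim : Tendsto (fun n : ℕ => Real.exp (γ * (t - x)) + G.real (Iic t) ^ n) atTop
      (𝓝 (Real.exp (γ * (t - x)))) := by
    simpa using (tendsto_pow_atTop_nhds_zero_of_lt_one measureReal_nonneg hq).const_add
      (Real.exp (γ * (t - x)))
  exact ge_of_tendsto' hlim fun n => main n x hx

/-- The lower bound matching Lundberg's inequality. -/
theorem exp_le_restartTail (hG : ∀ᵐ u ∂G, 0 < u) {t γ : ℝ} (hγ : 0 ≤ γ)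
    (hq : G.real (Iic t) < 1) (hψ : 1 ≤ ∫ u in Iic t, Real.exp (γ * u) ∂G) {x : ℝ} (hx : 0 ≤ x) :
    Real.exp (-(γ * x)) ≤ restartTail G t x := by
  -- The same iteration, with the exponential now a subsolution.
  have main : ∀ n : ℕ, ∀ x, 0 ≤ x →
      Real.exp (-(γ * x)) ≤ restartTail G t x + G.real (Iic t) ^ n := by
    intro n
    induction n with
    | zero =>
      intro x hx
      have := restartTail_nonneg G t x
      have : Real.exp (-(γ * x)) ≤ 1 := Real.exp_le_one_iff.2 (by nlinarith)
      rw [pow_zero]; linarith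
    | succ n ih =>
      intro x hx
      rcases lt_or_ge x t with hxt | hxt
      · have : Real.exp (-(γ * x)) ≤ 1 := Real.exp_le_one_iff.2 (by nlinarith)
        have : 0 ≤ G.real (Iic t) ^ (n + 1) := by positivity
        rw [restartTail_of_lt G hx hxt]
        linarith
      · have hi1 : IntegrableOn (fun u => Real.exp (-(γ * x)) * Real.exp (γ * u)) (Iic t) G :=
          (integrableOn_exp_mul_Iic G hγ t).const_mul _
        have hi2 : IntegrableOn (fun _ => G.real (Iic t) ^ n) (Iic t) G :=
          integrableOn_const (measure_ne_top _ _)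
        calc Real.exp (-(γ * x)) ≤ Real.exp (-(γ * x)) * ∫ u in Iic t, Real.exp (γ * u) ∂G :=
              le_mul_of_one_le_right (Real.exp_pos _).le hψ
          _ = ∫ u in Iic t, Real.exp (-(γ * x)) * Real.exp (γ * u) ∂G :=
              (integral_const_mul _ _).symm
          _ ≤ ∫ u in Iic t, (restartTail G t (x - u) + G.real (Iic t) ^ n) ∂G := by
              refine setIntegral_mono_on hi1 ((integrable_restartTail_shift G t x _).add hi2)
                measurableSet_Iic fun u hu => ?_
              have hu' : u ≤ t := hu
              have := ih (x - u) (by linarith)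
              rwa [show -(γ * (x - u)) = -(γ * x) + γ * u by ring, Real.exp_add] at this
          _ = _ := by
              rw [integral_add (integrable_restartTail_shift G t x _) hi2, setIntegral_const,
                smul_eq_mul, pow_succ', ← restartTail_renewal G hG hxt]
  have hlim : Tendsto (fun n : ℕ => restartTail G t x + G.real (Iic t) ^ n) atTop
      (𝓝 (restartTail G t x)) := by
    simpa using (tendsto_pow_atTop_nhds_zero_of_lt_one measureReal_nonneg hq).const_add
      (restartTail G t x)
  exact ge_of_tendsto' hlim fun n => main n x hx

end

/-- By independence the joint law of task and failures is `F` times an infinite product of copies of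
`G`; Fubini does the rest. -/
theorem IsModel.totalTail_eq {Ω : Type*} [MeasurableSpace Ω] {P : Measure Ω}
    [IsProbabilityMeasure P] {T : Ω → ℝ} {U : ℕ → Ω → ℝ} {F G : Measure ℝ}
    [IsProbabilityMeasure G] (h : IsModel P T U F G) (x : ℝ) :
    totalTail P T U x = ∫ t, restartTail G t x ∂F := by
  have hU : Measurable fun ω i => U i ω := measurable_pi_iff.2 h.measurable_failure
  have hF : IsFiniteMeasure F := h.law_task ▸ inferInstance
  have hlaw : P.map (fun ω => (T ω, fun i => U i ω)) =
      F.prod (Measure.infinitePi fun _ : ℕ => G) := by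
    rw [h.indepFun_task.map_prod_eq_prod_map_map h.measurable_task.aemeasurable hU.aemeasurable,
      h.law_task, h.iIndepFun_failure.map_fun_eq_infinitePi_map h.measurable_failure]
    simp_rw [h.law_failure]
  have hs : MeasurableSet {p : ℝ × (ℕ → ℝ) | ENNReal.ofReal x < restartTime p.1 p.2} :=
    measurableSet_lt measurable_const measurable_restartTime
  have key : P {ω | ENNReal.ofReal x < totalTime T U ω} =
      ∫⁻ t, (Measure.infinitePi fun _ : ℕ => G) {u | ENNReal.ofReal x < restartTime t u} ∂F := by
    simp_rw [totalTime_eq_restartTime]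
    have := Measure.prod_apply (μ := F) (ν := Measure.infinitePi fun _ : ℕ => G) hs
    rw [← hlaw, Measure.map_apply (h.measurable_task.prodMk hU) hs] at this
    exact this
  unfold totalTail restartTail Measure.real
  rw [integral_toReal, key]
  · exact (measurable_measure_prodMk_left hs).aemeasurable
  · exact ae_of_all _ fun a => measure_lt_top _ _

end Restart

/-- The Potter bound with exponent 1 gives `1 / L (1 / x) = O(x)`, so the denominator decays at most
polynomially. This disposes of the short tasks. -/
theorem IsSlowlyVaryingAtZero.tendsto_exp_neg_div {L : ℝ → ℝ} (hL : IsSlowlyVaryingAtZero L)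
    (β : ℝ) {γ : ℝ} (hγ : 0 < γ) :
    Tendsto (fun x => Real.exp (-(γ * x)) / (L (1 / x) / x ^ β)) atTop (𝓝 0) := by
  obtain ⟨s₀, hs₀, hpos, hpot⟩ := hL.exists_potter_bound one_pos
  have hz := (tendsto_rpow_mul_exp_neg_mul_atTop_nhds_zero (β + 1) γ hγ).const_mul
    (2 * (s₀ / 2) / L (s₀ / 2))
  rw [mul_zero] at hz
  have hLs : 0 < L (s₀ / 2) := hpos _ ⟨by linarith, by linarith⟩
  refine squeeze_zero' ?_ ?_ hz
  · filter_upwards [eventually_gt_atTop (1 / s₀), eventually_gt_atTop 0] with x hx hx0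
    have := hpos (1 / x) ⟨by positivity, by rwa [one_div_lt hx0 hs₀]⟩
    positivity
  · filter_upwards [eventually_ge_atTop (1 / (s₀ / 2)), eventually_gt_atTop 0] with x hx hx0
    have hx1 : 1 ≤ s₀ / 2 * x := by rwa [div_le_iff₀' (by linarith)] at hx
    have e : s₀ / 2 * x * (1 / x) = s₀ / 2 := by field_simp
    have h := (hpot (1 / x) (by positivity) (s₀ / 2 * x) hx1 (by rw [e]; linarith)).1
    rw [e, Real.rpow_one, Real.rpow_one] at h
    have hLx : 0 < L (1 / x) := by
      by_contra! hle
      have : 2 * (s₀ / 2 * x) * L (1 / x) ≤ 0 :=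
        mul_nonpos_of_nonneg_of_nonpos (by positivity) hle
      linarith
    have hLx' : 1 / L (1 / x) ≤ 2 * (s₀ / 2) / L (s₀ / 2) * x := by
      rw [div_mul_eq_mul_div, div_le_div_iff₀ hLx hLs, one_mul]
      linarith
    have hxb : 0 < x ^ β := by positivity
    calc Real.exp (-(γ * x)) / (L (1 / x) / x ^ β)
        = 1 / L (1 / x) * (x ^ β * Real.exp (-(γ * x))) := by
          rw [div_div_eq_mul_div]; ring
      _ ≤ 2 * (s₀ / 2) / L (s₀ / 2) * x * (x ^ β * Real.exp (-(γ * x))) :=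
          mul_le_mul_of_nonneg_right hLx' (by positivity)
      _ = 2 * (s₀ / 2) / L (s₀ / 2) * (x ^ (β + 1) * Real.exp (-γ * x)) := by
          rw [Real.rpow_add_one hx0.ne', neg_mul]; ring

/-! ### The tail of `G` and the change of variables to the uniform scale -/

section Tail

theorem distTail_nonneg (G : Measure ℝ) (t : ℝ) : 0 ≤ distTail G t := measureReal_nonneg

variable (G : Measure ℝ) [IsProbabilityMeasure G]

theorem distTail_antitone : Antitone (distTail G) := fun _ _ h =>
  measureReal_mono (Ioi_subset_Ioi h)

theorem distTail_le_one (t : ℝ) : distTail G t ≤ 1 := measureReal_le_one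

theorem measureReal_Iic_eq (t : ℝ) : G.real (Iic t) = 1 - distTail G t := by
  rw [distTail, ← compl_Iic, probReal_compl_eq_one_sub measurableSet_Iic, sub_sub_cancel]

theorem tendsto_distTail_atTop : Tendsto (distTail G) atTop (𝓝 0) := by
  have h := (tendsto_cdf_atTop G).const_sub 1
  rw [sub_self] at h
  refine h.congr fun t => ?_
  rw [cdf_eq_real, measureReal_Iic_eq, sub_sub_cancel]

theorem tendsto_distTail_atBot : Tendsto (distTail G) atBot (𝓝 1) := by
  have h := (tendsto_cdf_atBot G).const_sub 1
  rw [sub_zero] at h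
  refine h.congr fun t => ?_
  rw [cdf_eq_real, measureReal_Iic_eq, sub_sub_cancel]

theorem continuous_distTail [NullSingletonClass G] : Continuous (distTail G) := by
  have he : distTail G = fun t => ∫ u, (Ioi t).indicator (fun _ => (1 : ℝ)) u ∂G := by
    ext t
    rw [integral_indicator measurableSet_Ioi, setIntegral_const, smul_eq_mul, mul_one, distTail]
  rw [he, continuous_iff_continuousAt]
  intro t₀
  refine continuousAt_of_dominated (bound := fun _ => 1) ?_ ?_ (integrable_const _) ?_
  · exact Eventually.of_forall fun t =>
      (measurable_const.indicator measurableSet_Ioi).aestronglyMeasurable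
  · refine Eventually.of_forall fun t => ae_of_all _ fun u => ?_
    refine (norm_indicator_le_norm_self _ _).trans ?_
    simp
  · filter_upwards [compl_mem_ae_iff.2 (measure_singleton (μ := G) t₀)] with u hu
    have hne : u ≠ t₀ := hu
    rcases lt_or_gt_of_ne hne with h | h
    · refine (continuousAt_const (y := (0 : ℝ))).congr ?_
      filter_upwards [lt_mem_nhds h] with t ht
      rw [indicator_of_notMem (by simpa using ht.le)]
    · refine (continuousAt_const (y := (1 : ℝ))).congr ?_
      filter_upwards [gt_mem_nhds h] with t ht
      rw [indicator_of_mem (mem_Ioi.2 ht)]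

theorem exists_distTail_eq [NullSingletonClass G] {a : ℝ} (ha : a ∈ Ioo (0 : ℝ) 1) :
    ∃ t, distTail G t = a := by
  refine mem_range_of_exists_le_of_exists_ge (continuous_distTail G) ?_ ?_
  · obtain ⟨t, ht⟩ := ((tendsto_distTail_atTop G).eventually_lt_const ha.1).exists
    exact ⟨t, ht.le⟩
  · obtain ⟨t, ht⟩ := ((tendsto_distTail_atBot G).eventually_const_lt ha.2).exists
    exact ⟨t, ht.le⟩

theorem measureReal_distTail_le [NullSingletonClass G] {a : ℝ} (ha : a ∈ Ioo (0 : ℝ) 1) :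
    G.real {t | distTail G t ≤ a} = a := by
  apply le_antisymm
  -- The tail may be constant on intervals, so `distTail G v ≤ a` need not put `v` beyond a chosen
  -- point of level `a`; a point of level `b > a` avoids this.
  · refine le_of_forall_gt_imp_ge_of_dense fun b hb => ?_
    rcases lt_or_ge b 1 with hb1 | hb1
    · obtain ⟨t, ht⟩ := exists_distTail_eq G ⟨ha.1.trans hb, hb1⟩
      calc G.real {t | distTail G t ≤ a} ≤ G.real (Ioi t) := by
            refine measureReal_mono fun v hv => ?_
            have hv' : distTail G v ≤ a := hv
            by_contra hvt
            have := distTail_antitone G (not_lt.1 hvt)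
            linarith
        _ = b := ht
    · exact measureReal_le_one.trans hb1
  · obtain ⟨t, ht⟩ := exists_distTail_eq G ha
    calc a = G.real (Ioi t) := ht.symm
      _ ≤ _ := measureReal_mono fun v hv => (distTail_antitone G (le_of_lt hv)).trans ht.le

/-- The tail evaluated at a variable with that tail is uniform. -/
theorem map_distTail [NullSingletonClass G] (hpos : ∀ t, 0 < distTail G t) :
    G.map (distTail G) = volume.restrict (Ioo (0 : ℝ) 1) := by
  have hm : Measurable (distTail G) := (distTail_antitone G).measurable
  have : IsFiniteMeasure (G.map (distTail G)) := inferInstance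
  refine Measure.ext_of_Iic _ _ fun a => ?_
  rw [Measure.map_apply hm measurableSet_Iic, Measure.restrict_apply measurableSet_Iic]
  rcases le_or_gt a 0 with ha0 | ha0
  · have e1 : distTail G ⁻¹' Iic a = ∅ :=
      eq_empty_of_forall_notMem fun t ht => absurd (hpos t) (not_lt.2 (le_trans ht ha0))
    have e2 : Iic a ∩ Ioo (0 : ℝ) 1 = ∅ :=
      eq_empty_of_forall_notMem fun s hs => absurd hs.2.1 (not_lt.2 (le_trans hs.1 ha0))
    rw [e1, e2, measure_empty, measure_empty]
  rcases lt_or_ge a 1 with ha1 | ha1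
  · have e2 : Iic a ∩ Ioo (0 : ℝ) 1 = Ioc 0 a := by
      ext s
      simp only [mem_inter_iff, mem_Iic, mem_Ioo, mem_Ioc]
      exact ⟨fun h => ⟨h.2.1, h.1⟩, fun h => ⟨h.2, h.1, h.2.trans_lt ha1⟩⟩
    rw [e2, Real.volume_Ioc, sub_zero, ← measureReal_distTail_le G ⟨ha0, ha1⟩, ofReal_measureReal,
      measureReal_distTail_le G ⟨ha0, ha1⟩]
    rfl
  · have e1 : distTail G ⁻¹' Iic a = univ :=
      eq_univ_of_forall fun t => (distTail_le_one G t).trans ha1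
    have e2 : Iic a ∩ Ioo (0 : ℝ) 1 = Ioo 0 1 :=
      inter_eq_right.2 fun s hs => hs.2.le.trans ha1
    rw [e1, e2, measure_univ, Real.volume_Ioo]
    simp

end Tail

namespace IsDensityOnPos

variable {F G : Measure ℝ} {f g : ℝ → ℝ}

theorem ae_pos (hg : IsDensityOnPos G g) : ∀ᵐ u ∂G, 0 < u := by
  have h : G ≪ volume.restrict (Ioi (0 : ℝ)) := by
    rw [hg.eq_withDensity]; exact withDensity_absolutelyContinuous _ _
  exact h.ae_le (ae_restrict_mem measurableSet_Ioi)

theorem nullSingletonClass (hg : IsDensityOnPos G g) : NullSingletonClass G := by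
  refine ⟨fun x => ?_⟩
  have h : G ≪ volume.restrict (Ioi (0 : ℝ)) := by
    rw [hg.eq_withDensity]; exact withDensity_absolutelyContinuous _ _
  exact h (measure_singleton x)

/-- If `G` gave no mass to `(t, ∞)`, then `g`, and with it `f`, would vanish almost everywhere on
the positive part of that ray, bounding the support of `F`. -/
theorem distTail_pos [IsProbabilityMeasure G] (hf : IsDensityOnPos F f) (hg : IsDensityOnPos G g)
    (hF : ¬ BddAbove F.support) {k : ℝ → ℝ}
    (hfg : ∀ᵐ t ∂(volume.restrict (Ioi (0 : ℝ))), f t = g t * k t) (t : ℝ) :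
    0 < distTail G t := by
  refine lt_of_le_of_ne (distTail_nonneg G t) fun h0 => hF ?_
  have hG0 : G (Ioi t) = 0 := (measureReal_eq_zero_iff (measure_ne_top _ _)).1 h0.symm
  rw [hg.eq_withDensity, withDensity_apply _ measurableSet_Ioi,
    setLIntegral_eq_zero_iff measurableSet_Ioi hg.measurable.ennreal_ofReal] at hG0
  have hF0 : F (Ioi t) = 0 := by
    rw [hf.eq_withDensity, withDensity_apply _ measurableSet_Ioi,
      setLIntegral_eq_zero_iff measurableSet_Ioi hf.measurable.ennreal_ofReal]
    filter_upwards [hG0, hfg, ae_restrict_mem measurableSet_Ioi] with u hu huf hu0 hut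
    have h1 : g u = 0 := le_antisymm (ENNReal.ofReal_eq_zero.1 (hu hut)) (hg.nonneg u hu0)
    rw [huf, h1, zero_mul, ENNReal.ofReal_zero]
  refine ⟨t, fun u hu => ?_⟩
  by_contra! htu
  exact Measure.subset_compl_support_of_isOpen isOpen_Ioi hF0 (mem_Ioi.2 htu) hu

theorem lintegral_eq (hg : IsDensityOnPos G g) {ψ : ℝ → ℝ≥0∞} (hψ : AEMeasurable ψ G) :
    ∫⁻ t, ψ t ∂G = ∫⁻ t in Ioi 0, ENNReal.ofReal (g t) * ψ t := by
  obtain ⟨hm, -, rfl⟩ := hg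
  exact lintegral_withDensity_eq_lintegral_mul₀' hm.ennreal_ofReal.aemeasurable hψ

/-- Change of variables to the uniform scale `s = distTail G t`. -/
theorem lintegral_comp_distTail [IsProbabilityMeasure G] (hf : IsDensityOnPos F f)
    (hg : IsDensityOnPos G g) (hpos : ∀ t, 0 < distTail G t) {k : ℝ → ℝ}
    (hk : AEMeasurable k (volume.restrict (Ioi 0)))
    (hfg : ∀ᵐ t ∂(volume.restrict (Ioi (0 : ℝ))), f t = g t * k (distTail G t))
    {φ : ℝ → ℝ≥0∞} (hφ : Measurable φ) :
    ∫⁻ t, φ (distTail G t) ∂F = ∫⁻ s in Ioo 0 1, φ s * ENNReal.ofReal (k s) := by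
  have := hg.nullSingletonClass
  have hm : Measurable (distTail G) := (distTail_antitone G).measurable
  have hk' : AEMeasurable (fun s => φ s * ENNReal.ofReal (k s)) (G.map (distTail G)) := by
    rw [map_distTail G hpos]
    exact hφ.aemeasurable.mul
      (hk.mono_measure (Measure.restrict_mono Ioo_subset_Ioi_self le_rfl)).ennreal_ofReal
  rw [← map_distTail G hpos, lintegral_map' hk' hm.aemeasurable]
  rw [hg.lintegral_eq (ψ := fun t => φ (distTail G t) * ENNReal.ofReal (k (distTail G t)))
    (hk'.comp_measurable hm), hf.lintegral_eq (ψ := fun t => φ (distTail G t)) (hφ.comp hm).aemeasurable]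
  refine lintegral_congr_ae ?_
  filter_upwards [hfg, ae_restrict_mem measurableSet_Ioi] with t ht ht0
  rw [ht, ENNReal.ofReal_mul (hg.nonneg t ht0)]
  ring

end IsDensityOnPos

/-! ### Locating the decay rate near `μ * distTail G t` -/

section Cumulant

theorem tendsto_setIntegral_Iic_id {G : Measure ℝ} (hmean : Integrable (fun u : ℝ => u) G) :
    Tendsto (fun t => ∫ u in Iic t, u ∂G) atTop (𝓝 (∫ u, u ∂G)) :=
  (aecover_Iic tendsto_id).integral_tendsto_of_countably_generated hmean

variable {G : Measure ℝ} [IsProbabilityMeasure G]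

theorem integral_id_pos (hG : ∀ᵐ u ∂G, 0 < u) (hmean : Integrable (fun u : ℝ => u) G) :
    0 < ∫ u, u ∂G := by
  have hnn : 0 ≤ᵐ[G] fun u : ℝ => u := hG.mono fun u hu => hu.le
  refine lt_of_le_of_ne (integral_nonneg_of_ae hnn) fun h0 => ?_
  have h1 := (integral_eq_zero_iff_of_nonneg_ae hnn hmean).1 h0.symm
  obtain ⟨u, hu, hu'⟩ := (hG.and h1).exists
  exact hu.ne' hu'

/-- `t * distTail G t` is at most `∫ u in Ioi t, u ∂G`, the tail of a convergent integral. -/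
theorem tendsto_mul_distTail (hmean : Integrable (fun u : ℝ => u) G) :
    Tendsto (fun t => t * distTail G t) atTop (𝓝 0) := by
  have hlim := (tendsto_setIntegral_Iic_id hmean).const_sub (∫ u, u ∂G)
  rw [sub_self] at hlim
  refine squeeze_zero' ?_ ?_ hlim
  · filter_upwards [eventually_ge_atTop 0] with t ht
    exact mul_nonneg ht (distTail_nonneg G t)
  · refine Eventually.of_forall fun t => ?_
    have hsplit := integral_add_compl (measurableSet_Iic (a := t)) hmean
    rw [compl_Iic] at hsplit
    have h1 : t * distTail G t = ∫ _ in Ioi t, t ∂G := by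
      rw [setIntegral_const, smul_eq_mul, mul_comm, distTail]
    have h2 : ∫ _ in Ioi t, t ∂G ≤ ∫ u in Ioi t, u ∂G :=
      setIntegral_mono_on (integrableOn_const (measure_ne_top _ _)) hmean.integrableOn
        measurableSet_Ioi fun u hu => le_of_lt hu
    linarith

/-- By `1 + v ≤ exp v` the integral is at least `1 - distTail G t + γ * ∫ u in Iic t, u ∂G`, which
reaches 1 once the truncated mean exceeds the full mean divided by `c`. -/
theorem eventually_one_le_setIntegral_exp (hG : ∀ᵐ u ∂G, 0 < u)
    (hmean : Integrable (fun u : ℝ => u) G) {c : ℝ} (hc : 1 < c) :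
    ∀ᶠ t in atTop,
      1 ≤ ∫ u in Iic t, Real.exp (c * (1 / ∫ u, u ∂G) * distTail G t * u) ∂G := by
  have hM := integral_id_pos hG hmean
  have hlt : (∫ u, u ∂G) / c < ∫ u, u ∂G := div_lt_self hM hc
  filter_upwards [(tendsto_setIntegral_Iic_id hmean).eventually_const_lt hlt] with t ht
  set M := ∫ u, u ∂G
  set γ := c * (1 / M) * distTail G t with hγ
  have hγ0 : 0 ≤ γ := mul_nonneg (by positivity) (distTail_nonneg G t)
  have hi1 : IntegrableOn (fun u : ℝ => γ * u) (Iic t) G := hmean.integrableOn.const_mul _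
  have hi2 : IntegrableOn (fun _ : ℝ => (1 : ℝ)) (Iic t) G := integrableOn_const (measure_ne_top _ _)
  have h1 : ∫ u in Iic t, (γ * u + 1) ∂G ≤ ∫ u in Iic t, Real.exp (γ * u) ∂G :=
    setIntegral_mono_on (hi1.add hi2) (Restart.integrableOn_exp_mul_Iic G hγ0 t) measurableSet_Iic
      fun u _ => Real.add_one_le_exp _
  rw [integral_add hi1 hi2, integral_const_mul, setIntegral_const, smul_eq_mul, mul_one,
    measureReal_Iic_eq] at h1
  have h2 : distTail G t ≤ γ * ∫ u in Iic t, u ∂G := by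
    calc distTail G t = γ * (M / c) := by rw [hγ]; field_simp
      _ ≤ _ := mul_le_mul_of_nonneg_left ht.le hγ0
  linarith

theorem eventually_exp_mul_le (hmean : Integrable (fun u : ℝ => u) G) (a : ℝ) {K : ℝ}
    (hK : 1 < K) : ∀ᶠ t in atTop, Real.exp (a * distTail G t * t) ≤ K := by
  have h : Tendsto (fun t => Real.exp (a * (t * distTail G t))) atTop (𝓝 1) := by
    simpa [Function.comp_def] using (Real.continuous_exp.tendsto _).comp ((tendsto_mul_distTail hmean).const_mul a)
  filter_upwards [h.eventually_lt_const hK] with t ht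
  rw [mul_assoc, mul_comm (distTail G t)]
  exact ht.le

/-- For `v = γ * u` with `0 < u ≤ t`, `exp v ≤ 1 + v * exp v ≤ 1 + v / c`, since `exp (γ * t) ≤ 1 /
c` eventually. Integrating, the factor `c` in `γ` cancels `1 / c`. -/
theorem eventually_setIntegral_exp_le_one (hG : ∀ᵐ u ∂G, 0 < u)
    (hmean : Integrable (fun u : ℝ => u) G) {c : ℝ} (hc0 : 0 < c) (hc : c < 1) :
    ∀ᶠ t in atTop,
      ∫ u in Iic t, Real.exp (c * (1 / ∫ u, u ∂G) * distTail G t * u) ∂G ≤ 1 := by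
  have hM := integral_id_pos hG hmean
  filter_upwards [eventually_exp_mul_le hmean (c * (1 / ∫ u, u ∂G)) (one_lt_inv_iff₀.2 ⟨hc0, hc⟩)]
    with t ht
  set M := ∫ u, u ∂G with hMdef
  set γ := c * (1 / M) * distTail G t with hγ
  have hγ0 : 0 ≤ γ := mul_nonneg (by positivity) (distTail_nonneg G t)
  have hi1 : IntegrableOn (fun u : ℝ => γ * c⁻¹ * u) (Iic t) G := hmean.integrableOn.const_mul _
  have hi2 : IntegrableOn (fun _ : ℝ => (1 : ℝ)) (Iic t) G := integrableOn_const (measure_ne_top _ _)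
  have h1 : ∫ u in Iic t, Real.exp (γ * u) ∂G ≤ ∫ u in Iic t, (γ * c⁻¹ * u + 1) ∂G := by
    refine integral_mono_ae (Restart.integrableOn_exp_mul_Iic G hγ0 t) (hi1.add hi2) ?_
    filter_upwards [ae_restrict_mem measurableSet_Iic, ae_restrict_of_ae hG] with u hut hu0
    have hv : 0 ≤ γ * u := mul_nonneg hγ0 hu0.le
    have e1 : Real.exp (γ * u) ≤ c⁻¹ :=
      (Real.exp_le_exp.2 (mul_le_mul_of_nonneg_left hut hγ0)).trans ht
    have e2 := Real.add_one_le_exp (-(γ * u))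
    have e3 : Real.exp (γ * u) * Real.exp (-(γ * u)) = 1 := by
      rw [← Real.exp_add, add_neg_cancel, Real.exp_zero]
    have e4 := mul_le_mul_of_nonneg_left e2 (Real.exp_pos (γ * u)).le
    have e5 := mul_le_mul_of_nonneg_left e1 hv
    change Real.exp (γ * u) ≤ γ * c⁻¹ * u + 1
    nlinarith
  rw [integral_add hi1 hi2, integral_const_mul, setIntegral_const, smul_eq_mul, mul_one,
    measureReal_Iic_eq] at h1
  have h3 : ∫ u in Iic t, u ∂G ≤ M :=
    setIntegral_le_integral hmean (hG.mono fun u hu => hu.le)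
  have h2 : γ * c⁻¹ * ∫ u in Iic t, u ∂G ≤ distTail G t := by
    calc γ * c⁻¹ * ∫ u in Iic t, u ∂G ≤ γ * c⁻¹ * M :=
          mul_le_mul_of_nonneg_left h3 (mul_nonneg hγ0 (inv_pos.2 hc0).le)
      _ = distTail G t := by rw [hγ]; field_simp
  linarith

end Cumulant

/-- The cutoff `s₁` is there because `L₀`, hence the transformed density, has a guaranteed sign only
near 0. -/
theorem IsDensityOnPos.setIntegral_exp_distTail {F G : Measure ℝ} {f g : ℝ → ℝ}
    [IsProbabilityMeasure G] (hf : IsDensityOnPos F f)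
    (hg : IsDensityOnPos G g) (hpos : ∀ t, 0 < distTail G t) {k : ℝ → ℝ}
    (hk : AEMeasurable k (volume.restrict (Ioi 0)))
    (hfg : ∀ᵐ t ∂(volume.restrict (Ioi (0 : ℝ))), f t = g t * k (distTail G t))
    {s₁ : ℝ} (hs₁ : s₁ ≤ 1) (hk0 : ∀ s ∈ Ioo 0 s₁, 0 ≤ k s) (r : ℝ) :
    ∫ t in {t | distTail G t < s₁}, Real.exp (-(r * distTail G t)) ∂F =
      ∫ s in Ioo 0 s₁, Real.exp (-(r * s)) * k s := by
  have hm : Measurable (distTail G) := (distTail_antitone G).measurable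
  have hs : MeasurableSet {t | distTail G t < s₁} := measurableSet_lt hm measurable_const
  rw [integral_eq_lintegral_of_nonneg_ae (ae_of_all _ fun t => (Real.exp_pos _).le)
      (by fun_prop), integral_eq_lintegral_of_nonneg_ae]
  · congr 1
    have hφ : Measurable ((Iio s₁).indicator fun s => ENNReal.ofReal (Real.exp (-(r * s)))) :=
      Measurable.indicator (by fun_prop) measurableSet_Iio
    have h := hf.lintegral_comp_distTail hg hpos hk hfg hφ
    rw [← lintegral_indicator hs]
    refine Eq.trans (lintegral_congr fun t => rfl) (h.trans ?_)
    have e : Ioo 0 s₁ = Iio s₁ ∩ Ioo (0 : ℝ) 1 := by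
      ext s
      simp only [mem_inter_iff, mem_Iio, mem_Ioo]
      exact ⟨fun h => ⟨h.2, h.1, h.2.trans_le hs₁⟩, fun h => ⟨h.2.1, h.1⟩⟩
    rw [e, ← Measure.restrict_restrict measurableSet_Iio, ← lintegral_indicator measurableSet_Iio]
    refine lintegral_congr fun s => ?_
    by_cases h : s ∈ Iio s₁
    · rw [indicator_of_mem h, indicator_of_mem h, ENNReal.ofReal_mul (Real.exp_pos _).le]
    · rw [indicator_of_notMem h, indicator_of_notMem h, zero_mul]
  · filter_upwards [ae_restrict_mem measurableSet_Ioo] with s hs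
    exact mul_nonneg (Real.exp_pos _).le (hk0 s hs)
  · exact ((by fun_prop : Measurable fun s => Real.exp (-(r * s))).aemeasurable.mul
      (hk.mono_measure (Measure.restrict_mono Ioo_subset_Ioi_self le_rfl))).aestronglyMeasurable

/-! ### Integration over the task length -/

section Sandwich

variable {F G : Measure ℝ} {f g : ℝ → ℝ} [IsProbabilityMeasure F] [IsProbabilityMeasure G]
  {β : ℝ} {L : ℝ → ℝ}

theorem integrable_restartTail (x : ℝ) : Integrable (fun t => Restart.restartTail G t x) F :=
  Integrable.of_bound (Restart.measurable_restartTail_left G x).aestronglyMeasurable 1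
    (ae_of_all _ fun t => by
      rw [Real.norm_of_nonneg (Restart.restartTail_nonneg G _ _)]
      exact Restart.restartTail_le_one G _ _)

theorem integrableOn_exp_neg_distTail {a : ℝ} (ha : 0 ≤ a) (s : Set ℝ) :
    IntegrableOn (fun t => Real.exp (-(a * distTail G t))) s F := by
  have hm : Measurable (distTail G) := (distTail_antitone G).measurable
  refine Integrable.of_bound (by fun_prop) 1 (ae_of_all _ fun t => ?_)
  rw [Real.norm_of_nonneg (Real.exp_pos _).le, Real.exp_le_one_iff]
  have := mul_nonneg ha (distTail_nonneg G t)
  linarith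

/-- Short tasks are discarded; on long ones the exponential lower bound integrates to the Laplace
transform of the Abelian theorem with `r = c * μ`. -/
theorem eventually_lt_integral_restartTail_div (hf : IsDensityOnPos F f) (hg : IsDensityOnPos G g)
    (hpos : ∀ t, 0 < distTail G t) (hmean : Integrable (fun u : ℝ => u) G) (hβ : 0 < β)
    (hL : IsSlowlyVaryingAtZero L)
    (hfg : ∀ᵐ t ∂(volume.restrict (Ioi (0 : ℝ))),
      f t = g t * (distTail G t ^ (β - 1) * L (distTail G t)))
    {c : ℝ} (hc : 1 < c) {b : ℝ}
    (hb : b < Real.Gamma β / (c * (1 / ∫ u, u ∂G)) ^ β) :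
    ∀ᶠ x in atTop, b < (∫ t, Restart.restartTail G t x ∂F) / (L (1 / x) / x ^ β) := by
  have hG := hg.ae_pos
  have hM := integral_id_pos hG hmean
  obtain ⟨s₀, hs₀, hLpos, habel⟩ := hL.exists_abelian hβ
  obtain ⟨t₀, ht₀⟩ := eventually_atTop.1 (eventually_one_le_setIntegral_exp hG hmean hc)
  set μ := 1 / ∫ u, u ∂G with hμ
  have hμ0 : 0 < μ := by positivity
  have hr : 0 < c * μ := by positivity
  -- Below `s₀` the function `L` is positive; a tail below `distTail G t₀` forces `t ≥ t₀`, as the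
  -- tail is antitone.
  set s₁ := min s₀ (distTail G t₀) with hs₁
  have hs₁0 : 0 < s₁ := lt_min hs₀ (hpos t₀)
  have hs₁1 : s₁ ≤ 1 := (min_le_right _ _).trans (distTail_le_one G t₀)
  have hk : AEMeasurable (fun s => s ^ (β - 1) * L s) (volume.restrict (Ioi 0)) :=
    (by fun_prop : Measurable fun s : ℝ => s ^ (β - 1)).aemeasurable.mul hL.aemeasurable
  have hk0 : ∀ s ∈ Ioo 0 s₁, 0 ≤ s ^ (β - 1) * L s := fun s hs =>
    mul_nonneg (Real.rpow_nonneg hs.1.le _) (hLpos s ⟨hs.1, hs.2.trans_le (min_le_left _ _)⟩).le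
  have hB : MeasurableSet {t | distTail G t < s₁} :=
    measurableSet_lt (distTail_antitone G).measurable measurable_const
  filter_upwards [(habel s₁ ⟨hs₁0, min_le_left _ _⟩ (c * μ) hr).eventually_const_lt hb,
    eventually_gt_atTop 0, eventually_gt_atTop (1 / s₀)] with x hx hx0 hxs
  have hLx : 0 < L (1 / x) := hLpos _ ⟨by positivity, by rwa [one_div_lt hx0 hs₀]⟩
  refine hx.trans_le (div_le_div_of_nonneg_right ?_ (by positivity))
  rw [← hf.setIntegral_exp_distTail hg hpos hk hfg hs₁1 hk0]
  refine le_trans (setIntegral_mono_on (integrableOn_exp_neg_distTail (by positivity) _)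
    (integrable_restartTail x).integrableOn hB fun t ht => ?_)
    (setIntegral_le_integral (integrable_restartTail x)
      (ae_of_all _ fun t => Restart.restartTail_nonneg G t x))
  have ht' : distTail G t < distTail G t₀ := lt_of_lt_of_le ht (min_le_right _ _)
  have htt : t₀ ≤ t := by
    by_contra! hlt
    exact absurd (distTail_antitone G hlt.le) (not_le.2 ht')
  have hq : G.real (Iic t) < 1 := by rw [measureReal_Iic_eq]; linarith [hpos t]
  have := Restart.exp_le_restartTail G hG (mul_nonneg hr.le (hpos t).le) hq (ht₀ t htt) hx0.le
  rwa [mul_right_comm] at this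

/-- On long tasks `K` absorbs the factor `exp (γ * t)` of Lundberg's inequality; the other tasks
share one exponential rate. -/
theorem eventually_integral_restartTail_div_lt (hf : IsDensityOnPos F f) (hg : IsDensityOnPos G g)
    (hpos : ∀ t, 0 < distTail G t) (hmean : Integrable (fun u : ℝ => u) G) (hβ : 0 < β)
    (hL : IsSlowlyVaryingAtZero L)
    (hfg : ∀ᵐ t ∂(volume.restrict (Ioi (0 : ℝ))),
      f t = g t * (distTail G t ^ (β - 1) * L (distTail G t)))
    {c : ℝ} (hc0 : 0 < c) (hc : c < 1) {K : ℝ} (hK : 1 < K) {b : ℝ}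
    (hb : K * (Real.Gamma β / (c * (1 / ∫ u, u ∂G)) ^ β) < b) :
    ∀ᶠ x in atTop, (∫ t, Restart.restartTail G t x ∂F) / (L (1 / x) / x ^ β) < b := by
  have hG := hg.ae_pos
  have hM := integral_id_pos hG hmean
  obtain ⟨s₀, hs₀, hLpos, habel⟩ := hL.exists_abelian hβ
  obtain ⟨t₀, ht₀⟩ := eventually_atTop.1 ((eventually_setIntegral_exp_le_one hG hmean hc0 hc).and
    (eventually_exp_mul_le hmean (c * (1 / ∫ u, u ∂G)) hK))
  set μ := 1 / ∫ u, u ∂G with hμ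
  have hμ0 : 0 < μ := by positivity
  have hr : 0 < c * μ := by positivity
  set s₁ := min s₀ (distTail G t₀) with hs₁
  have hs₁0 : 0 < s₁ := lt_min hs₀ (hpos t₀)
  have hs₁1 : s₁ ≤ 1 := (min_le_right _ _).trans (distTail_le_one G t₀)
  have hk : AEMeasurable (fun s => s ^ (β - 1) * L s) (volume.restrict (Ioi 0)) :=
    (by fun_prop : Measurable fun s : ℝ => s ^ (β - 1)).aemeasurable.mul hL.aemeasurable
  have hk0 : ∀ s ∈ Ioo 0 s₁, 0 ≤ s ^ (β - 1) * L s := fun s hs =>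
    mul_nonneg (Real.rpow_nonneg hs.1.le _) (hLpos s ⟨hs.1, hs.2.trans_le (min_le_left _ _)⟩).le
  have hB : MeasurableSet {t | distTail G t < s₁} :=
    measurableSet_lt (distTail_antitone G).measurable measurable_const
  have hge : ∀ {t}, distTail G t < s₁ → t₀ ≤ t := by
    intro t ht
    by_contra! hlt
    exact absurd (distTail_antitone G hlt.le) (not_le.2 (ht.trans_le (min_le_right _ _)))
  have hq : ∀ t, G.real (Iic t) < 1 := fun t => by rw [measureReal_Iic_eq]; linarith [hpos t]
  -- Every task outside the long range has `t ≤ t₁`. The rate belonging to `t₁` is admissible for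
  -- all of them, since the truncated exponential integral increases with `t`.
  obtain ⟨t₁, ht₁⟩ := ((tendsto_distTail_atTop G).eventually_lt_const hs₁0).exists
  have hγ : 0 < c * μ * distTail G t₁ := mul_pos hr (hpos t₁)
  have hlim := ((habel s₁ ⟨hs₁0, min_le_left _ _⟩ (c * μ) hr).const_mul K).add
    ((hL.tendsto_exp_neg_div β hγ).const_mul K)
  rw [mul_zero, add_zero] at hlim
  filter_upwards [hlim.eventually_lt_const hb,
    eventually_gt_atTop 0, eventually_gt_atTop (1 / s₀)] with x hx hx0 hxs
  have hLx : 0 < L (1 / x) := hLpos _ ⟨by positivity, by rwa [one_div_lt hx0 hs₀]⟩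
  refine lt_of_le_of_lt ?_ hx
  rw [← mul_div_assoc K, ← mul_div_assoc K, ← add_div]
  refine div_le_div_of_nonneg_right ?_ (by positivity)
  rw [← hf.setIntegral_exp_distTail hg hpos hk hfg hs₁1 hk0,
    ← integral_add_compl hB (integrable_restartTail x)]
  refine add_le_add ?_ ?_
  · rw [← integral_const_mul]
    refine setIntegral_mono_on (integrable_restartTail x).integrableOn
      ((integrableOn_exp_neg_distTail (by positivity) _).const_mul K) hB fun t ht => ?_
    have h := Restart.restartTail_le_exp G hG (mul_nonneg hr.le (hpos t).le) (hq t)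
      (ht₀ t (hge ht)).1 hx0.le
    rw [mul_sub, sub_eq_add_neg, Real.exp_add, mul_right_comm _ _ x] at h
    exact h.trans (mul_le_mul_of_nonneg_right (ht₀ t (hge ht)).2 (Real.exp_pos _).le)
  · have hbd : ∀ t ∈ {t | distTail G t < s₁}ᶜ, Restart.restartTail G t x ≤
        K * Real.exp (-(c * μ * distTail G t₁ * x)) := by
      intro t ht
      have ht' : s₁ ≤ distTail G t := not_lt.1 ht
      have htt : t ≤ t₁ := by
        by_contra! hlt
        exact absurd (distTail_antitone G hlt.le) (not_le.2 (ht₁.trans_le ht'))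
      have hψ : ∫ u in Iic t, Real.exp (c * μ * distTail G t₁ * u) ∂G ≤ 1 :=
        (setIntegral_mono_set (Restart.integrableOn_exp_mul_Iic G hγ.le t₁)
          (ae_of_all _ fun u => (Real.exp_pos _).le)
          (Iic_subset_Iic.2 htt).eventuallyLE).trans (ht₀ t₁ (hge ht₁)).1
      have h := Restart.restartTail_le_exp G hG hγ.le (hq t) hψ hx0.le
      rw [mul_sub, sub_eq_add_neg, Real.exp_add] at h
      refine h.trans (mul_le_mul_of_nonneg_right ?_ (Real.exp_pos _).le)
      exact (Real.exp_le_exp.2 (mul_le_mul_of_nonneg_left htt hγ.le)).trans (ht₀ t₁ (hge ht₁)).2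
    calc ∫ t in {t | distTail G t < s₁}ᶜ, Restart.restartTail G t x ∂F
        ≤ ∫ _ in {t | distTail G t < s₁}ᶜ, K * Real.exp (-(c * μ * distTail G t₁ * x)) ∂F :=
          setIntegral_mono_on (integrable_restartTail x).integrableOn
            (integrableOn_const (measure_ne_top _ _)) hB.compl hbd
      _ ≤ K * Real.exp (-(c * μ * distTail G t₁ * x)) := by
          rw [setIntegral_const, smul_eq_mul]
          exact mul_le_of_le_one_left (by positivity) measureReal_le_one

end Sandwich

/-! ### Conclusion: letting `c` tend to 1 -/

theorem mainTheorem1 {Ω : Type*} [MeasurableSpace Ω] (P : Measure Ω) [IsProbabilityMeasure P]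
    (T : Ω → ℝ) (U : ℕ → Ω → ℝ) (F G : Measure ℝ) (f g : ℝ → ℝ)
    (hmodel : Restart.IsModel P T U F G)
    (hf : IsDensityOnPos F f) (hg : IsDensityOnPos G g)
    (hF : ¬ BddAbove F.support)
    (hmean : Integrable (fun u : ℝ => u) G)
    (μ : ℝ) (hμ : μ = 1 / ∫ u, u ∂G)
    (β : ℝ) (hβ : 0 < β)
    (L₀ : ℝ → ℝ) (hL₀ : IsSlowlyVaryingAtZero L₀)
    (hfg : ∀ᵐ t ∂(volume.restrict (Ioi (0 : ℝ))),
      f t = g t * distTail G t ^ (β - 1) * L₀ (distTail G t)) :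
    Tendsto
      (fun x : ℝ => Restart.totalTail P T U x /
        (Real.Gamma β / μ ^ β * (L₀ (1 / x) / x ^ β)))
      atTop (𝓝 1) := by
  have : IsProbabilityMeasure F := by
    rw [← hmodel.law_task]
    exact Measure.isProbabilityMeasure_map hmodel.measurable_task.aemeasurable
  have : IsProbabilityMeasure G := by
    rw [← hmodel.law_failure 0]
    exact Measure.isProbabilityMeasure_map (hmodel.measurable_failure 0).aemeasurable
  simp_rw [mul_assoc] at hfg
  have hpos := hf.distTail_pos hg hF hfg
  have hM := integral_id_pos hg.ae_pos hmean
  have hμ0 : 0 < μ := by rw [hμ]; positivity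
  have hΓ : 0 < Real.Gamma β := Real.Gamma_pos_of_pos hβ
  have hC : 0 < Real.Gamma β / μ ^ β := by positivity
  have hscale : ∀ c : ℝ, 0 < c → Real.Gamma β / (c * μ) ^ β = Real.Gamma β / μ ^ β * c ^ (-β) := by
    intro c hc
    rw [Real.mul_rpow hc.le hμ0.le, Real.rpow_neg hc.le]
    field_simp
  have hcont : ContinuousAt (fun c : ℝ => c ^ (-β)) 1 :=
    Real.continuousAt_rpow_const 1 (-β) (Or.inl one_ne_zero)
  simp_rw [hmodel.totalTail_eq, mul_comm (Real.Gamma β / μ ^ β), ← div_div]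
  rw [tendsto_order]
  constructor
  · intro a ha
    have h1 : ∀ᶠ c : ℝ in 𝓝[>] 1, a < c ^ (-β) :=
      (hcont.tendsto.mono_left nhdsWithin_le_nhds).eventually_const_lt (by simpa using ha)
    obtain ⟨c, hac, hc⟩ := (h1.and self_mem_nhdsWithin).exists
    have hc1 : 1 < c := hc
    have hb : a * (Real.Gamma β / μ ^ β) < Real.Gamma β / (c * (1 / ∫ u, u ∂G)) ^ β := by
      rw [← hμ, hscale c (by linarith), mul_comm]
      exact mul_lt_mul_of_pos_left hac hC
    filter_upwards [eventually_lt_integral_restartTail_div hf hg hpos hmean hβ hL₀ hfg hc1 hb]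
      with x hx
    rwa [lt_div_iff₀ hC]
  · intro a ha
    -- The upper bound is applied with `K = c⁻¹`, so a single parameter controls both losses.
    have hcont' : ContinuousAt (fun c : ℝ => c⁻¹ * c ^ (-β)) 1 :=
      (continuousAt_inv₀ one_ne_zero).mul hcont
    have h1 : ∀ᶠ c : ℝ in 𝓝[<] 1, c⁻¹ * c ^ (-β) < a :=
      (hcont'.tendsto.mono_left nhdsWithin_le_nhds).eventually_lt_const (by simpa using ha)
    have h2 : ∀ᶠ c : ℝ in 𝓝[<] 1, 0 < c :=
      (tendsto_id.mono_left nhdsWithin_le_nhds).eventually_const_lt one_pos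
    obtain ⟨c, ⟨hac, hc0⟩, hc⟩ := ((h1.and h2).and self_mem_nhdsWithin).exists
    have hc1 : c < 1 := hc
    have hb : c⁻¹ * (Real.Gamma β / (c * (1 / ∫ u, u ∂G)) ^ β) < a * (Real.Gamma β / μ ^ β) := by
      rw [← hμ, hscale c hc0, mul_left_comm, mul_comm a]
      exact mul_lt_mul_of_pos_left hac hC
    filter_upwards [eventually_integral_restartTail_div_lt hf hg hpos hmean hβ hL₀ hfg hc0 hc1
      (one_lt_inv_iff₀.2 ⟨hc0, hc1⟩) hb] with x hx
    rwa [div_lt_iff₀ hC]
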